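/- Let $M$ be a matroid with no loops, of rank $r$, on a finite set $E$ with $|E|=n$. For a finite matroid $N$ on a set $S$, with rank function $\mathrm{rk}_N$, let $$T(N;x,y)=\sum_{A\subseteq S}(x-1)^{\mathrm{rk}_N(S)-\mathrm{rk}_N(A)}(y-1)^{|A|-\mathrm{rk}_N(A)}$$ be its Tutte polynomial, and let $\mu(N)$ be its Möbius invariant: $\mu(N)=(-1)^{\mathrm{rk}_N(S)}\mu_N(\emptyset,S)$ if $N$ has no loops, where $\mu_N$ is the Möbius function of the lattice of flats of $N$, and $\mu(N)=0$ if $N$ has loops. Binomial coefficients $\binom{a}{b}$ are $a(a-1)\cdots(a-b+1)/b!$ for integers $b\ge 0$ and $0$ for $b<0$. Then $$\mu(M)=\binom{n-1}{n-r}+\sum_{X}(-1)^{r-\mathrm{rk}(X)}\,\mu(M/X)\binom{|X|-1}{|X|-r},$$ $$T(M;1,1)=\binom{n}{r}+\sum_{X}(-1)^{r-\mathrm{rk}(X)}\,\mu(M/X)\binom{|X|}{r},$$ where both sums range over all flats $X$ of $M$ having rank less than $r$, and $M/X$ is the contraction. (Thus $(-1)^{r-\mathrm{rk}(X)}\mu(M/X)=\mu_M(X,E)$.)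 -/

import Mathlib

namespace MatroidTutte

/-- The rank of a set `A` in a matroid, as a natural number (used for finite matroids). -/
noncomputable def rk {α : Type*} (M : Matroid α) (A : Set α) : ℕ := (M.eRk A).toNat

/-- The ground set of a finite matroid as a `Finset`. -/
noncomputable def ground {α : Type*} (M : Matroid α) [M.Finite] : Finset α :=
  M.ground_finite.toFinset

/-- The Tutte polynomial
`T(M; x, y) = ∑_{A ⊆ E} (x - 1) ^ (r - rk A) (y - 1) ^ (|A| - rk A)` of a finite matroid of rank
`r`, where `x = X 0` and `y = X 1`. -/
noncomputable def tutte {α : Type*} (M : Matroid α) [M.Finite] : MvPolynomial (Fin 2) ℤ :=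
  ∑ A ∈ (ground M).powerset,
    (MvPolynomial.X 0 - 1) ^ (rk M M.E - rk M (A : Set α)) *
      (MvPolynomial.X 1 - 1) ^ (A.card - rk M (A : Set α))

/-- The evaluation `T(M; x, y)` at integers. -/
noncomputable def tutteEval {α : Type*} (M : Matroid α) [M.Finite] (x y : ℤ) : ℤ :=
  MvPolynomial.eval ![x, y] (tutte M)

/-- The poset (in fact a lattice) of flats of a matroid, ordered by inclusion. -/
abbrev Flat {α : Type*} (M : Matroid α) : Type _ := {F : Set α // M.IsFlat F}

instance finite_flat {α : Type*} (M : Matroid α) [M.Finite] : Finite (Flat M) :=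
  (M.ground_finite.finite_subsets.subset fun _ hF => hF.subset_ground).to_subtype

noncomputable instance locallyFiniteOrder_flat {α : Type*} (M : Matroid α) [M.Finite] :
    LocallyFiniteOrder (Flat M) :=
  LocallyFiniteOrder.ofFiniteIcc fun _ _ => Set.toFinite _

/-- The least flat `cl(∅)`. -/
def botFlat {α : Type*} (M : Matroid α) : Flat M := ⟨M.closure ∅, M.isFlat_closure ∅⟩

/-- The greatest flat, the ground set. -/
def topFlat {α : Type*} (M : Matroid α) : Flat M := ⟨M.E, M.ground_isFlat⟩

open scoped Classical in
/-- The Möbius invariant `μ(M)`: it is `(-1) ^ r * μ_M(∅, E)`, with `r` the rank of `M` and `μ_M`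
the Möbius function of the lattice of flats, if `M` has no loops, and `0` if `M` has loops. -/
noncomputable def mobiusInvariant {α : Type*} (M : Matroid α) [M.Finite] : ℤ :=
  if M.Loopless then
    (-1) ^ rk M M.E * IncidenceAlgebra.mu ℤ (botFlat M) (topFlat M)
  else 0

open scoped Classical in
/-- The flats of rank less than `r`, as a `Finset`. -/
noncomputable def flatsBelow {α : Type*} (M : Matroid α) [M.Finite] (r : ℕ) :
    Finset (Finset α) :=
  (ground M).powerset.filter fun X => M.IsFlat (X : Set α) ∧ rk M (X : Set α) < r

/-- The binomial coefficient `a (a - 1) ⋯ (a - b + 1) / b!` of integers, which is `0` for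
`b < 0` and `1` for `b = 0`. -/
def binom (a b : ℤ) : ℤ := if b < 0 then 0 else Ring.choose a b.toNat

end MatroidTutte

namespace MatroidTutte

/-! Both formulas come from one Möbius inversion. Since `weight M X` is `μ_M(X, E)`, any function
`g` on subsets of `E` satisfies `∑_X μ_M(X, E) ∑_{A ⊆ X} g A = ∑_{A spanning} g A`, with `X` over
all flats (`sum_weight_mul_sum_powerset`). If `g` is the indicator of `|A| = r`, the right side
counts bases, which is `T(M; 1, 1)`. If `g A = (-1)^|A|` for `|A| < r` and `0` otherwise, the right
side vanishes, and the inner sums are signed binomials except at `X = ∅`, whose extra term yields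
`μ(M)`. The flat `E` has weight `1` and gives the leading terms. -/

/-- The Möbius function is preserved by an order embedding whose range is an upper set. -/
lemma mu_orderEmbedding {P Q : Type*} [PartialOrder P] [PartialOrder Q] [LocallyFiniteOrder P]
    [LocallyFiniteOrder Q] [DecidableEq P] [DecidableEq Q] [Finite P] (f : P ↪o Q)
    (hf : ∀ a x, f a ≤ x → x ∈ Set.range f) (a b : P) :
    IncidenceAlgebra.mu ℤ (f a) (f b) = IncidenceAlgebra.mu ℤ a b := by
  induction b using WellFoundedLT.induction with
  | ind b ih =>
    rw [IncidenceAlgebra.mu_apply, IncidenceAlgebra.mu_apply a b]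
    have hI : Finset.Ico (f a) (f b) = (Finset.Ico a b).map f.toEmbedding := by
      ext x
      simp only [Finset.mem_Ico, Finset.mem_map, RelEmbedding.coe_toEmbedding]
      constructor
      · rintro ⟨h1, h2⟩
        obtain ⟨y, rfl⟩ := hf a x h1
        exact ⟨y, ⟨f.le_iff_le.1 h1, f.lt_iff_lt.1 h2⟩, rfl⟩
      · rintro ⟨y, ⟨h1, h2⟩, rfl⟩
        exact ⟨f.le_iff_le.2 h1, f.lt_iff_lt.2 h2⟩
    rw [hI, Finset.sum_map]
    simp only [EmbeddingLike.apply_eq_iff_eq, RelEmbedding.coe_toEmbedding]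
    congr 2
    exact Finset.sum_congr rfl fun x hx => ih x (Finset.mem_Ico.1 hx).2

section

variable {α : Type*} {M : Matroid α}

/-! ### Flats and rank of a contraction -/

lemma isFlat_contract_iff {X F : Set α} (hX : X ⊆ M.E) :
    (M.contract X).IsFlat F ↔ M.IsFlat (F ∪ X) ∧ Disjoint F X := by
  rw [Matroid.isFlat_iff_closure_eq, Matroid.isFlat_iff_closure_eq, Matroid.contract_closure_eq]
  constructor
  · intro h
    have hd : Disjoint F X := by rw [← h]; exact Set.disjoint_sdiff_left
    refine ⟨?_, hd⟩
    have hs : X ⊆ M.closure (F ∪ X) := M.subset_closure_of_subset' Set.subset_union_right hX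
    conv_rhs => rw [← h]
    rw [Set.sdiff_union_of_subset hs]
  · rintro ⟨h, hd⟩
    rw [h, Set.union_sdiff_right, hd.sdiff_eq_left]

/-- The flats of `M ／ X` are the flats of `M` above `X`, with `X` removed. -/
def flatContractEmbedding {X : Set α} (hX : X ⊆ M.E) : Flat (M.contract X) ↪o Flat M where
  toFun F := ⟨F.1 ∪ X, ((isFlat_contract_iff hX).1 F.2).1⟩
  inj' F G h := by
    have hF := ((isFlat_contract_iff hX).1 F.2).2
    have hG := ((isFlat_contract_iff hX).1 G.2).2
    have h' : F.1 ∪ X = G.1 ∪ X := congrArg Subtype.val h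
    apply Subtype.ext
    rw [← hF.sdiff_eq_left, ← hG.sdiff_eq_left, ← Set.union_sdiff_right, h', Set.union_sdiff_right]
  map_rel_iff' {F G} := by
    have hF := ((isFlat_contract_iff hX).1 F.2).2
    change F.1 ∪ X ⊆ G.1 ∪ X ↔ F.1 ⊆ G.1
    refine ⟨fun h x hx => ?_, fun h => Set.union_subset_union_left _ h⟩
    exact (h (Or.inl hx)).resolve_right (Set.disjoint_left.1 hF hx)

lemma mem_range_flatContractEmbedding {X : Set α} (hX : X ⊆ M.E) {G : Flat M} (h : X ⊆ G.1) :
    G ∈ Set.range (flatContractEmbedding hX) := by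
  have hG : G.1 \ X ∪ X = G.1 := Set.sdiff_union_of_subset h
  refine ⟨⟨G.1 \ X, (isFlat_contract_iff hX).2 ⟨?_, Set.disjoint_sdiff_left⟩⟩, Subtype.ext hG⟩
  rw [hG]
  exact G.2

/-- If a basis `I` of `X` is extended to a base `B` of `M`, then `B \ X` is a base of the
contraction. -/
lemma eRk_add_eRank_contract {X : Set α} (hX : X ⊆ M.E) :
    M.eRk X + (M.contract X).eRank = M.eRank := by
  obtain ⟨I, hI⟩ := M.exists_isBasis X
  obtain ⟨B, hB, hIB⟩ := hI.indep.exists_isBase_superset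
  have hBX : B ∩ X = I := (hI.eq_of_subset_indep (hB.indep.inter_right X)
    (Set.subset_inter hIB hI.subset) Set.inter_subset_right).symm
  have hd : B \ X ∪ I = B := by rw [← hBX, Set.sdiff_union_inter]
  have hb := hB.isBasis_ground.contract_isBasis hI (by rw [hd]; exact hB.indep)
  rw [← Matroid.contract_ground, Matroid.isBasis_ground_iff] at hb
  rw [← hb.encard_eq_eRank, ← hB.encard_eq_eRank, ← hI.encard_eq_eRk, ← hBX, add_comm,
    Set.encard_sdiff_add_encard_inter]

variable [M.Finite]

lemma eRk_ne_top (A : Set α) : M.eRk A ≠ ⊤ :=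
  Matroid.eRk_ne_top_iff.2 (M.isRkFinite_set A)

lemma natCast_rk (A : Set α) : (rk M A : ℕ∞) = M.eRk A := ENat.natCast_toNat (eRk_ne_top A)

@[simp] lemma coe_ground : (ground M : Set α) = M.E := by simp [ground]

lemma rk_contract_ground {X : Set α} (hX : X ⊆ M.E) :
    rk (M.contract X) (M.contract X).E = rk M M.E - rk M X := by
  have h := eRk_add_eRank_contract hX
  rw [← M.eRk_ground, ← (M.contract X).eRk_ground, ← natCast_rk, ← natCast_rk, ← natCast_rk] at h
  have h' : rk M X + rk (M.contract X) (M.contract X).E = rk M M.E := by exact_mod_cast h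
  omega

open scoped Classical in
/-- The signed Möbius invariant of the contraction of a flat `X` is `μ_M(X, E)`. -/
lemma neg_one_pow_mul_mobiusInvariant_contract (X : Flat M) :
    (-1) ^ (rk M M.E - rk M X.1) * mobiusInvariant (M.contract X.1) =
      IncidenceAlgebra.mu ℤ X (topFlat M) := by
  have hX := X.2.subset_ground
  have hl : (M.contract X.1).Loopless := by
    rw [Matroid.loopless_iff, Matroid.contract_loops_eq, X.2.closure, Set.sdiff_self]
  have hbot : flatContractEmbedding hX (botFlat (M.contract X.1)) = X := by
    apply Subtype.ext
    change (M.contract X.1).closure ∅ ∪ X.1 = X.1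
    rw [Matroid.contract_closure_eq, Set.empty_union, X.2.closure, Set.sdiff_self,
      Set.empty_union]
  have htop : flatContractEmbedding hX (topFlat (M.contract X.1)) = topFlat M :=
    Subtype.ext (Set.sdiff_union_of_subset hX)
  rw [mobiusInvariant, if_pos hl, rk_contract_ground hX, ← mul_assoc, ← pow_add,
    Even.neg_one_pow ⟨_, rfl⟩, one_mul,
    ← mu_orderEmbedding (flatContractEmbedding hX)
      (fun a x h => mem_range_flatContractEmbedding hX (Set.subset_union_right.trans h)),
    hbot, htop]

/-! ### Möbius inversion over flats -/

open scoped Classical in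
/-- The flats of a finite matroid, as a `Finset`. -/
noncomputable def flats (M : Matroid α) [M.Finite] : Finset (Finset α) :=
  (ground M).powerset.filter fun X => M.IsFlat (X : Set α)

/-- The number `μ_M(X, E)`, expressed through the Möbius invariant of `M ／ X`. -/
noncomputable def weight (M : Matroid α) [M.Finite] (X : Finset α) : ℤ :=
  (-1) ^ (rk M M.E - rk M (X : Set α)) * mobiusInvariant (M.contract (X : Set α))

open scoped Classical in
lemma weight_eq_mu {X : Finset α} {F : Flat M} (h : (X : Set α) = F.1) :
    weight M X = IncidenceAlgebra.mu ℤ F (topFlat M) := by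
  obtain ⟨F, hF⟩ := F
  obtain rfl : (X : Set α) = F := h
  have h' := neg_one_pow_mul_mobiusInvariant_contract (⟨X, hF⟩ : Flat M)
  dsimp only at h'
  rw [weight, h']

-- A flat contains `A` exactly when it contains `cl(A)`, so this is the defining sum of `μ` over the
-- interval `[cl(A), E]`.
open scoped Classical in
lemma sum_weight_flats_superset {A : Finset α} (hA : A ⊆ ground M) :
    ∑ X ∈ flats M with A ⊆ X, weight M X = if M.closure (A : Set α) = M.E then 1 else 0 := by
  have hA' : (A : Set α) ⊆ M.E := by rw [← coe_ground]; exact_mod_cast hA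
  have h := IncidenceAlgebra.sum_Icc_mu_left (𝕜 := ℤ)
    (⟨M.closure A, M.isFlat_closure A⟩ : Flat M) (topFlat M)
  simp only [topFlat, Subtype.mk.injEq] at h
  rw [← h]
  symm
  refine Finset.sum_bij (fun F _ => (M.ground_finite.subset F.2.subset_ground).toFinset)
    ?_ ?_ ?_ ?_
  · intro F hF
    have h1 : M.closure A ⊆ F.1 := (Finset.mem_Icc.1 hF).1
    simp only [flats, Finset.mem_filter, Finset.mem_powerset, Set.Finite.coe_toFinset]
    refine ⟨⟨?_, F.2⟩, ?_⟩
    · rw [← Finset.coe_subset, coe_ground, Set.Finite.coe_toFinset]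
      exact F.2.subset_ground
    · rw [← Finset.coe_subset, Set.Finite.coe_toFinset]
      exact (M.subset_closure A hA').trans h1
  · intro F _ G _ hFG
    exact Subtype.ext (Set.Finite.toFinset_inj.1 hFG)
  · intro X hX
    simp only [flats, Finset.mem_filter, Finset.mem_powerset] at hX
    refine ⟨⟨X, hX.1.2⟩, Finset.mem_Icc.2 ⟨?_, hX.1.2.subset_ground⟩, by simp⟩
    exact (M.closure_subset_closure (Finset.coe_subset.2 hX.2)).trans_eq hX.1.2.closure
  · intro F _
    exact (weight_eq_mu (Set.Finite.coe_toFinset _)).symm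

open scoped Classical in
lemma sum_weight_mul_sum_powerset (g : Finset α → ℤ) :
    ∑ X ∈ flats M, weight M X * ∑ A ∈ X.powerset, g A =
      ∑ A ∈ (ground M).powerset.filter (fun A : Finset α => M.closure (A : Set α) = M.E), g A := by
  simp_rw [Finset.mul_sum]
  rw [Finset.sum_comm' (t' := (ground M).powerset) (s' := fun A => {X ∈ flats M | A ⊆ X}),
    Finset.sum_filter]
  · refine Finset.sum_congr rfl fun A hA => ?_
    rw [← Finset.sum_mul, sum_weight_flats_superset (Finset.mem_powerset.1 hA)]
    split_ifs <;> simp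
  · intro X A
    simp only [flats, Finset.mem_filter, Finset.mem_powerset]
    exact ⟨fun h => ⟨⟨h.1, h.2⟩, h.2.trans h.1.1⟩, fun h => h.1⟩

lemma closure_eq_ground_iff {A : Set α} (hA : A ⊆ M.E) :
    M.closure A = M.E ↔ rk M A = rk M M.E := by
  rw [← Matroid.spanning_iff_closure_eq hA, Matroid.spanning_iff_eRk_le hA, ← M.eRk_ground,
    ← natCast_rk, ← natCast_rk, Nat.cast_le]
  have : rk M A ≤ rk M M.E := by
    rw [← Nat.cast_le (α := ℕ∞), natCast_rk, natCast_rk]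
    exact M.eRk_mono hA
  omega

lemma rk_le_card (A : Finset α) : rk M (A : Set α) ≤ A.card := by
  rw [← Nat.cast_le (α := ℕ∞), natCast_rk, ← Set.encard_coe_eq_coe_finsetCard]
  exact M.eRk_le_encard _

open scoped Classical in
lemma flats_eq_insert : flats M = insert (ground M) (flatsBelow M (rk M M.E)) := by
  ext X
  simp only [flats, flatsBelow, Finset.mem_insert, Finset.mem_filter, Finset.mem_powerset]
  constructor
  · rintro ⟨h, hF⟩
    have h' : (X : Set α) ⊆ M.E := hF.subset_ground
    by_cases hr : rk M X = rk M M.E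
    · left
      rw [← closure_eq_ground_iff h', hF.closure] at hr
      exact Finset.coe_injective (by rw [hr, coe_ground])
    · right
      refine ⟨h, hF, lt_of_le_of_ne ?_ hr⟩
      rw [← Nat.cast_le (α := ℕ∞), natCast_rk, natCast_rk]
      exact M.eRk_mono h'
  · rintro (rfl | h)
    · exact ⟨subset_rfl, by rw [coe_ground]; exact M.ground_isFlat⟩
    · exact ⟨h.1, h.2.1⟩

lemma ground_notMem_flatsBelow : ground M ∉ flatsBelow M (rk M M.E) := by
  simp [flatsBelow]

lemma weight_ground : weight M (ground M) = 1 := by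
  classical
  rw [weight_eq_mu (F := topFlat M) coe_ground, IncidenceAlgebra.mu_self]

lemma sum_flats_weight (f : Finset α → ℤ) :
    ∑ X ∈ flats M, weight M X * f X =
      f (ground M) + ∑ X ∈ flatsBelow M (rk M M.E), weight M X * f X := by
  classical
  rw [flats_eq_insert, Finset.sum_insert ground_notMem_flatsBelow, weight_ground, one_mul]

/-! ### Counting bases -/

lemma tutteEval_one_one :
    tutteEval M 1 1 = ∑ X ∈ flats M, weight M X * (X.card.choose (rk M M.E) : ℤ) := by
  classical
  have h := sum_weight_mul_sum_powerset (M := M)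
    (fun A => if A.card = rk M M.E then (1 : ℤ) else 0)
  have h1 : ∀ X : Finset α, (∑ A ∈ X.powerset, if A.card = rk M M.E then (1 : ℤ) else 0) =
      (X.card.choose (rk M M.E) : ℤ) := by
    intro X
    rw [← Finset.sum_filter, ← Finset.powersetCard_eq_filter, Finset.sum_const,
      Finset.card_powersetCard, nsmul_one]
  simp_rw [h1] at h
  rw [h, tutteEval, tutte, map_sum (MvPolynomial.eval ![1, 1]), Finset.sum_filter]
  refine Finset.sum_congr rfl fun A hA => ?_
  have hA' : (A : Set α) ⊆ M.E := by
    rw [← coe_ground]; exact_mod_cast Finset.mem_powerset.1 hA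
  have h2 : rk M A ≤ rk M M.E := by
    rw [← Nat.cast_le (α := ℕ∞), natCast_rk, natCast_rk]
    exact M.eRk_mono hA'
  have h3 := rk_le_card (M := M) A
  -- As `0 ^ 0 = 1`, a term survives only if both exponents vanish: `A` is spanning and `|A| = r`.
  simp only [closure_eq_ground_iff hA', map_mul, map_pow, map_sub, MvPolynomial.eval_X, map_one,
    Matrix.cons_val_zero, Matrix.cons_val_one, sub_self, zero_pow_eq]
  split_ifs <;> omega

/-! ### The Möbius invariant -/

/-- The alternating sum of the binomial coefficients up to `k`. -/
lemma sum_range_neg_one_pow_mul_choose (m k : ℕ) :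
    ∑ i ∈ Finset.range (k + 1), (-1 : ℤ) ^ i * ((m + 1).choose i : ℤ) =
      (-1) ^ k * (m.choose k : ℤ) := by
  induction k with
  | zero => simp
  | succ k ih =>
    rw [Finset.sum_range_succ, ih, Nat.choose_succ_succ]
    push_cast
    ring

lemma sum_powerset_card_lt (X : Finset α) (r : ℕ) :
    (∑ A ∈ X.powerset, if A.card < r then (-1 : ℤ) ^ A.card else 0) =
      ∑ i ∈ Finset.range r, (-1 : ℤ) ^ i * (X.card.choose i : ℤ) := by
  classical
  rw [← Finset.sum_filter, ← Finset.sum_fiberwise_of_maps_to (t := Finset.range r)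
    (g := Finset.card) (by simp)]
  refine Finset.sum_congr rfl fun i hi => ?_
  have : {A ∈ {A ∈ X.powerset | A.card < r} | A.card = i} = Finset.powersetCard i X := by
    ext A
    have := Finset.mem_range.1 hi
    simp only [Finset.mem_filter, Finset.mem_powerset, Finset.mem_powersetCard]
    constructor
    · exact fun h => ⟨h.1.1, h.2⟩
    · exact fun h => ⟨⟨h.1, by omega⟩, h.2⟩
  rw [this, Finset.sum_congr rfl (g := fun _ => (-1 : ℤ) ^ i)
    (fun A hA => by rw [(Finset.mem_powersetCard.1 hA).2]), Finset.sum_const,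
    Finset.card_powersetCard, nsmul_eq_mul, mul_comm]

/-- The case `m = 0` is separate because the truncated `m - 1` would give `1` at `k = 0`, whereas
the lower index on the left is negative. -/
lemma binom_natCast_sub_one (m k : ℕ) :
    binom (((m : ℕ) : ℤ) - 1) ((m : ℤ) - ((k + 1 : ℕ) : ℤ)) =
      if m = 0 then 0 else ((m - 1).choose k : ℤ) := by
  rcases m with _ | m
  · simp only [binom, if_true]
    rw [if_pos (by push_cast; omega)]
  · have h1 : ((m + 1 : ℕ) : ℤ) - 1 = (m : ℕ) := by push_cast; ring
    rw [h1, binom, if_neg (Nat.succ_ne_zero m), Nat.add_sub_cancel]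
    split_ifs with h
    · rw [Nat.choose_eq_zero_of_lt (by push_cast at h; omega), Nat.cast_zero]
    · have h2 : (((m + 1 : ℕ) : ℤ) - ((k + 1 : ℕ) : ℤ)).toNat = m - k := by omega
      rw [h2, Ring.choose_natCast, Nat.choose_symm (by push_cast at h; omega)]

lemma weight_empty :
    weight M ∅ = (-1) ^ rk M M.E * mobiusInvariant M := by
  have : ∀ N : Matroid α, ∀ [N.Finite], N = M → mobiusInvariant N = mobiusInvariant M := by
    rintro N _ rfl; rfl
  rw [weight, this _ (by rw [Finset.coe_empty, M.contract_empty])]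
  simp [rk]

lemma mobiusInvariant_eq_sum_flats [M.Loopless] :
    mobiusInvariant M =
      ∑ X ∈ flats M, weight M X * binom ((X.card : ℤ) - 1) ((X.card : ℤ) - rk M M.E) := by
  classical
  have hE : (∅ : Finset α) ∈ flats M := by
    simp only [flats, Finset.mem_filter, Finset.mem_powerset, Finset.empty_subset, true_and,
      Finset.coe_empty, Matroid.isFlat_iff_closure_eq]
    exact M.loops_eq_empty
  -- In rank `0`, looplessness forces `E = ∅`; the truncated alternating sum needs `r = k + 1`.
  rcases hr : rk M M.E with _ | k
  · have hg : (ground M) = ∅ := by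
      have h : M.closure ∅ = M.E := by
        rw [closure_eq_ground_iff (Set.empty_subset _), hr]
        simp [rk]
      rw [← Finset.coe_eq_empty, coe_ground, ← h]
      exact M.loops_eq_empty
    have h1 := weight_ground (M := M)
    rw [hg, weight_empty, hr, pow_zero, one_mul] at h1
    have h2 := sum_flats_weight (M := M) (fun X => binom ((X.card : ℤ) - 1) (X.card - (0 : ℕ)))
    rw [h2, h1, hr, hg]
    simp [binom, flatsBelow]
  · have h := sum_weight_mul_sum_powerset (M := M)
      (fun A => if A.card < k + 1 then (-1 : ℤ) ^ A.card else 0)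
    -- A spanning set has at least `r` elements, so `g` vanishes on it.
    rw [Finset.sum_eq_zero (s := Finset.filter _ _)] at h
    swap
    · intro A hA
      simp only [Finset.mem_filter, Finset.mem_powerset] at hA
      have hA' : (A : Set α) ⊆ M.E := by
        rw [← coe_ground]; exact_mod_cast hA.1
      have h1 := (closure_eq_ground_iff hA').1 hA.2
      have h2 := rk_le_card (M := M) A
      rw [if_neg (by omega)]
    -- For `X = ∅` the sum is `1` while the binomial is `0`, hence the correction.
    have key : ∀ X : Finset α, (∑ A ∈ X.powerset, if A.card < k + 1 then (-1 : ℤ) ^ A.card else 0) =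
        (-1) ^ k * binom ((X.card : ℤ) - 1) ((X.card : ℤ) - ((k + 1 : ℕ) : ℤ)) +
          if X = ∅ then 1 else 0 := by
      intro X
      rw [sum_powerset_card_lt, binom_natCast_sub_one]
      rcases X.eq_empty_or_nonempty with rfl | hX
      · simp [Finset.sum_range_succ']
      · obtain ⟨m, hm⟩ := Nat.exists_eq_succ_of_ne_zero (Finset.card_pos.2 hX).ne'
        rw [hm, Nat.succ_eq_add_one, sum_range_neg_one_pow_mul_choose, if_neg hX.ne_empty]
        simp
    simp_rw [key, mul_add, mul_ite, mul_one, mul_zero] at h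
    rw [Finset.sum_add_distrib, Finset.sum_ite_eq' (flats M) ∅, if_pos hE, weight_empty, hr] at h
    simp_rw [mul_left_comm _ ((-1 : ℤ) ^ k)] at h
    rw [← Finset.mul_sum, pow_succ, mul_assoc, ← mul_add] at h
    have h' := (mul_eq_zero.1 h).resolve_left (pow_ne_zero _ (by norm_num))
    linarith

end

end MatroidTutte

theorem mainTheorem6 {α : Type*} (M : Matroid α) [M.Finite] [M.Loopless] (n r : ℕ)
    (hn : M.E.ncard = n) (hr : M.eRank = r) :
    MatroidTutte.mobiusInvariant M =
        MatroidTutte.binom ((n : ℤ) - 1) ((n : ℤ) - r) +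
          ∑ X ∈ MatroidTutte.flatsBelow M r,
            (-1) ^ (r - MatroidTutte.rk M (X : Set α)) *
              MatroidTutte.mobiusInvariant (M.contract (X : Set α)) *
              MatroidTutte.binom ((X.card : ℤ) - 1) ((X.card : ℤ) - r) ∧
      MatroidTutte.tutteEval M 1 1 =
        (n.choose r : ℤ) +
          ∑ X ∈ MatroidTutte.flatsBelow M r,
            (-1) ^ (r - MatroidTutte.rk M (X : Set α)) *
              MatroidTutte.mobiusInvariant (M.contract (X : Set α)) *
              (X.card.choose r : ℤ) := by
  have hr' : MatroidTutte.rk M M.E = r := by rw [MatroidTutte.rk, M.eRk_ground, hr, ENat.toNat_natCast]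
  have hn' : (MatroidTutte.ground M).card = n := by
    rw [← hn, ← MatroidTutte.coe_ground, Set.ncard_coe_finset]
  subst hr' hn'
  refine ⟨?_, ?_⟩
  · rw [MatroidTutte.mobiusInvariant_eq_sum_flats, MatroidTutte.sum_flats_weight]
    rfl
  · rw [MatroidTutte.tutteEval_one_one,
      MatroidTutte.sum_flats_weight (fun X => (X.card.choose (MatroidTutte.rk M M.E) : ℤ))]
    rfl
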